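/- Let $(\Omega,\mathcal F,\mathbf P)$ be a probability space equipped with a (measurable) metric $\mathrm{dist}$ such that $\int_\Omega \mathrm{dist}^2(o,x)\,\mathbf P(dx)<\infty$ for some $o\in\Omega$. Let $T_1,\dots,T_M$ be $\mathbf P$-preserving transition kernels on $\Omega$, identified with the Markov operators $(T_if)(x)=\int f(y)\,T_i(x,dy)$, and let $T_1^\star,\dots,T_M^\star$ be transition kernels of the adjoint operators, i.e. $\mathbf E[(T_i^\star f)g]=\mathbf E[(T_ig)f]$ for all $f,g\in L^2(\mathbf P)$. Let $(\theta_1,\dots,\theta_M)$ be a probability vector. For probability measures $\mu,\nu$ on $\Omega$ let $W_1(\mu,\nu)=\inf \mathbb E[\mathrm{dist}(X,Y)]$ and $W_\infty(\mu,\nu)=\inf\operatorname{ess\,sup}\mathrm{dist}(X,Y)$, the infima being over all random pairs $(X,Y)$ with $X\sim\mu$, $Y\sim\nu$. For $f\colon\Omega\to\mathbb R$ let $\mathrm{Lip}(f)$ be the infimum over all null sets $N$ of $\sup\{|f(x)-f(y)|/\mathrm{dist}(x,y) : x,y\in\Omega\setminus N,\ x\neq y\}$. Assume that for some numbers $\ell_1,\dots,\ell_M\ge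 0$ and some $\kappa\in[0,1]$: (i) for each $i$ there is a null set $N\subset\Omega$ such that $W_\infty(T_i^\star(x,\cdot),T_i^\star(y,\cdot))\le \ell_i\,\mathrm{dist}(x,y)$ for all $x,y\in\Omega\setminus N$; (ii) there is a null set $N\subset\Omega$ such that $\sum_{i=1}^M\theta_i\ell_i\,W_1(T_i(x,\cdot),T_i(y,\cdot))\le(1-\kappa)\,\mathrm{dist}(x,y)$ for all $x,y\in\Omega\setminus N$; (iii) for each $i$ and each $f\in L^\infty(\mathbf P)$, $\mathrm{Lip}(T_if)<\infty$. Then, for every $f\in L\log L$, i.e. every measurable $f\colon\Omega\to[0,\infty)$ with $\mathbf E|f\log f|<\infty$, each $T_i^\star f$ is in $L\log L$ and $$\sum_{i=1}^M\theta_i\,\mathrm{Ent}(T_i^\star f)\;\le\;(1-\kappa)\,\mathrm{Ent}(f),\qquad \mathrm{Ent}(f):=\mathbf E[f\log f]-\mathbf E[f]\log\mathbf E[f].$$ -/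

import Mathlib

open MeasureTheory ProbabilityTheory
open scoped ENNReal NNReal

noncomputable section

namespace EntContr

variable {Ω : Type*} [MeasurableSpace Ω]

/-- The Markov operator of a transition kernel: `(T f)(x) = ∫ f(y) T(x, dy)`. -/
def op (T : Kernel Ω Ω) (f : Ω → ℝ) (x : Ω) : ℝ := ∫ y, f y ∂(T x)

/-- `S` is a transition kernel of the adjoint Markov operator of `T`:
`E[(S f) g] = E[(T g) f]` for all `f, g ∈ L²(P)`. -/
def IsAdjoint (P : Measure Ω) (T S : Kernel Ω Ω) : Prop :=
  ∀ f g : Ω → ℝ, MemLp f 2 P → MemLp g 2 P →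
    ∫ x, op S f x * g x ∂P = ∫ x, op T g x * f x ∂P

/-- The class `L log L` of measurable functions `f : Ω → [0, ∞)` with `E|f log f| < ∞`. -/
structure LLogL (P : Measure Ω) (f : Ω → ℝ) : Prop where
  measurable : Measurable f
  nonneg : ∀ x, 0 ≤ f x
  integrable : Integrable (fun x => f x * Real.log (f x)) P

/-- `Ent(f) = E[f log f] - E[f] log E[f]`. -/
def ent (P : Measure Ω) (f : Ω → ℝ) : ℝ :=
  ∫ x, f x * Real.log (f x) ∂P - (∫ x, f x ∂P) * Real.log (∫ x, f x ∂P)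

/-- `γ` is the joint law of a random pair with marginals `μ` and `ν`. -/
def IsCoupling (μ ν : Measure Ω) (γ : Measure (Ω × Ω)) : Prop :=
  γ.map Prod.fst = μ ∧ γ.map Prod.snd = ν

section Metric

variable [MetricSpace Ω]

/-- The `L¹`-Wasserstein distance: the infimum of `E[dist(X, Y)]` over couplings. -/
def W1 (μ ν : Measure Ω) : ℝ≥0∞ :=
  ⨅ (γ : Measure (Ω × Ω)) (_ : IsCoupling μ ν γ), ∫⁻ p, edist p.1 p.2 ∂γ

/-- The `L^∞`-Wasserstein distance: the infimum of `ess sup dist(X, Y)` over couplings. -/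
def WInf (μ ν : Measure Ω) : ℝ≥0∞ :=
  ⨅ (γ : Measure (Ω × Ω)) (_ : IsCoupling μ ν γ), essSup (fun p => edist p.1 p.2) γ

/-- The essential Lipschitz constant: the infimum, over null sets `N`, of the supremum of
`|f(x) - f(y)| / dist(x, y)` over distinct `x, y` outside `N`. -/
def essLip (P : Measure Ω) (f : Ω → ℝ) : ℝ≥0∞ :=
  ⨅ (N : Set Ω) (_ : P N = 0), ⨆ (x : Ω) (_ : x ∉ N) (y : Ω) (_ : y ∉ N) (_ : x ≠ y),
    ENNReal.ofReal (|f x - f y| / dist x y)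

end Metric

end EntContr

end

/-!
Write `Ent(f) = E[f log f] - E[f] log E[f]`, let `S i` be the adjoint kernels, and put
`c = 1 - κ`. It suffices to show, for each `lam > c` and each bounded measurable `u`, that the
deficit `J(u) = lam Ent(e^u) - ∑ i, θ i Ent(S i e^u)` is nonnegative: one then lets `lam` tend to
`c`, and passes to `L log L` by truncation and dominated convergence, Jensen's inequality
`φ(S i f) ≤ S i (φ ∘ f)` for `φ(t) = t log t` providing the domination
(`tendsto_ent_op_truncation`).

The averaged entropy `f ↦ ∑ i, θ i Ent(S i f)` lies above its linearisation at `e^u`, which by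
adjunction is `f ↦ E[f (G - log m)]` with `G = ∑ i, θ i T i (log S i e^u)` and `m = E[e^u]`
(`le_sum_ent_op`, `sum_ent_op_eq`). Replacing the averaged entropy by this linearisation, and
`Ent(f)` by its upper bound `E[f log f] - E[f] log m - E[f] + m`, gives an upper bound of the
deficit which is exact at `e^u`, and whose minimiser among functions with values in `[e^{-B}, e^B]`
is explicit: its logarithm is the truncation to `[-B, B]` of `log m + (G - log m) / lam`. Passing
from `u` to this logarithm hence decreases the deficit (`deficit_descent_le`).

The curvature assumptions say that this step contracts Lipschitz constants: the `W∞` bound gives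
`Lip(log S i e^u) ≤ ℓ i Lip(u)` (`EssLipschitz.logOp`), the averaged `W₁` bound then gives
`Lip(G) ≤ c Lip(u)` (`essLipschitz_sum_op`), truncation does not increase Lipschitz constants, and
the factor `c / lam` is smaller than `1`. Along the iteration the Lipschitz constants tend to `0`
while the functions stay in `[-B, B]`, hence their entropies tend to `0`
(`ent_exp_le_of_essLipschitz`); since `Ent(S i f) ≤ Ent(f)`, the lower limit of the deficits is
nonnegative, and so is the initial deficit (`deficit_nonneg_of_essLipschitz`). The regularity
assumption ensures that the first step produces an essentially Lipschitz function from any bounded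
one (`sum_ent_op_exp_le`).
-/

namespace EntContr

variable {Ω : Type*} [MeasurableSpace Ω] {P : Measure Ω} {S T : Kernel Ω Ω}

/-! ### Markov operators -/

lemma measurable_op (S : Kernel Ω Ω) {f : Ω → ℝ} (hf : Measurable f) : Measurable (op S f) :=
  (hf.stronglyMeasurable.integral_kernel).measurable

lemma integrable_of_abs_le {α : Type*} [MeasurableSpace α] {μ : Measure α} [IsFiniteMeasure μ]
    {f : α → ℝ} {B : ℝ} (hf : Measurable f) (hB : ∀ x, |f x| ≤ B) : Integrable f μ :=
  Integrable.of_bound hf.aestronglyMeasurable B (Filter.Eventually.of_forall hB)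

lemma memLp_of_abs_le {α : Type*} [MeasurableSpace α] {μ : Measure α} [IsFiniteMeasure μ]
    {f : α → ℝ} {B : ℝ} (p : ℝ≥0∞) (hf : Measurable f) (hB : ∀ x, |f x| ≤ B) : MemLp f p μ :=
  MemLp.of_bound hf.aestronglyMeasurable B (Filter.Eventually.of_forall hB)

/-- A transition kernel of the adjoint of a Markov operator preserves the measure: test the
adjoint relation against the constant function `1`. -/
lemma IsAdjoint.invariant [IsProbabilityMeasure P] [IsMarkovKernel T] [IsMarkovKernel S]
    (h : IsAdjoint P T S) : S.Invariant P := by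
  refine Measure.ext fun A hA => ?_
  have h1 := h (A.indicator 1) 1
    (memLp_of_abs_le (B := 1) 2 (measurable_one.indicator hA) fun x => by
      by_cases hx : x ∈ A <;> simp [hx])
    (memLp_of_abs_le (B := 1) 2 measurable_one fun x => by simp)
  have h2 : op T 1 = 1 := by ext x; simp [op]
  have h3 : op S (A.indicator 1) = fun x => (S x).real A := by
    ext x; simp [op, integral_indicator_one hA]
  simp only [h2, h3, Pi.one_apply, mul_one, one_mul, integral_indicator_one hA] at h1
  rw [Measure.bind_apply hA S.aemeasurable]
  have h4 : ∫ x, (S x).real A ∂P = (∫⁻ x, S x A ∂P).toReal := by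
    refine integral_toReal (S.measurable_coe hA).aemeasurable ?_
    exact Filter.Eventually.of_forall fun x => measure_lt_top _ _
  rw [h4] at h1
  refine (ENNReal.toReal_eq_toReal_iff' ?_ (measure_ne_top _ _)).1 h1
  refine ne_top_of_le_ne_top ENNReal.one_ne_top ?_
  calc ∫⁻ x, S x A ∂P ≤ ∫⁻ _, 1 ∂P := lintegral_mono fun x => prob_le_one
    _ = 1 := by simp

lemma ae_ae_of_invariant (hS : S.Invariant P) {p : Ω → Prop} (h : ∀ᵐ x ∂P, p x) :
    ∀ᵐ x ∂P, ∀ᵐ y ∂(S x), p y :=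
  Measure.ae_ae_of_ae_bind S.aemeasurable (by rwa [hS.def])

lemma ae_integrable_of_invariant [IsProbabilityMeasure P] [IsMarkovKernel S]
    (hS : S.Invariant P) {f : Ω → ℝ} (hf : Integrable f P) : ∀ᵐ x ∂P, Integrable f (S x) :=
  Measure.ae_integrable_of_integrable_comp (μ := P) (κ := S) (by rwa [hS.def])

lemma integrable_op [IsProbabilityMeasure P] [IsMarkovKernel S]
    (hS : S.Invariant P) {f : Ω → ℝ} (hfm : Measurable f) (hf : Integrable f P) :
    Integrable (op S f) P := by
  refine (Measure.integrable_integral_norm_of_integrable_comp (μ := P) (κ := S)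
    (f := f) (by rwa [hS.def])).mono' (measurable_op S hfm).aestronglyMeasurable ?_
  exact Filter.Eventually.of_forall fun x => norm_integral_le_integral_norm _

lemma integral_op [IsProbabilityMeasure P] [IsMarkovKernel S]
    (hS : S.Invariant P) {f : Ω → ℝ} (hf : Integrable f P) :
    ∫ x, op S f x ∂P = ∫ x, f x ∂P := by
  have h : S ∘ₘ P = P := hS.def
  have h' : Integrable f ((S ∘ₖ Kernel.const Unit P) ()) := by
    rwa [← Measure.comp_eq_comp_const_apply, h]
  have := Kernel.integral_comp h'
  rw [← Measure.comp_eq_comp_const_apply, h] at this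
  simpa [op] using this.symm

/-! ### Entropy inequalities -/

lemma sub_one_le_mul_log {t : ℝ} (ht : 0 ≤ t) : t - 1 ≤ t * Real.log t := by
  rcases ht.eq_or_lt with rfl | ht
  · simp
  · have := Real.one_sub_inv_le_log_of_pos ht
    have h2 := mul_le_mul_of_nonneg_left this ht.le
    rwa [mul_sub, mul_one, mul_inv_cancel₀ ht.ne'] at h2

lemma neg_one_le_mul_log {t : ℝ} (ht : 0 ≤ t) : -1 ≤ t * Real.log t := by
  linarith [sub_one_le_mul_log ht]

/-- Convexity of `t ↦ t log t`, in the form of its tangent at `s`. -/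
lemma mul_log_tangent {s t : ℝ} (hs : 0 < s) (ht : 0 < t) :
    t * Real.log s + t - s ≤ t * Real.log t := by
  have h := Real.log_le_sub_one_of_pos (div_pos hs ht)
  rw [Real.log_div hs.ne' ht.ne'] at h
  have h2 := mul_le_mul_of_nonneg_left h ht.le
  rw [mul_sub, mul_sub, mul_div_cancel₀ _ ht.ne'] at h2
  linarith

lemma LLogL.measurable_mul_log {f : Ω → ℝ} (hf : LLogL P f) :
    Measurable fun x => f x * Real.log (f x) :=
  hf.measurable.mul hf.measurable.log

lemma LLogL.integrable_self [IsProbabilityMeasure P] {f : Ω → ℝ} (hf : LLogL P f) :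
    Integrable f P := by
  refine (hf.integrable.add (integrable_const (1 : ℝ))).mono' hf.measurable.aestronglyMeasurable
    (Filter.Eventually.of_forall fun x => ?_)
  rw [Real.norm_eq_abs, abs_of_nonneg (hf.nonneg x)]
  have := sub_one_le_mul_log (hf.nonneg x)
  simp only [Pi.add_apply]
  linarith

/-- Jensen's inequality for `t ↦ t log t` along a Markov kernel. -/
lemma op_mul_log_le [IsProbabilityMeasure P] [IsMarkovKernel S] (hS : S.Invariant P)
    {f : Ω → ℝ} (hf : LLogL P f) :
    ∀ᵐ x ∂P, op S f x * Real.log (op S f x) ≤ op S (fun y => f y * Real.log (f y)) x := by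
  filter_upwards [ae_integrable_of_invariant hS hf.integrable_self,
    ae_integrable_of_invariant hS hf.integrable] with x h1 h2
  exact Real.convexOn_mul_log.map_integral_le Real.continuous_mul_log.continuousOn isClosed_Ici
    (Filter.Eventually.of_forall fun y => hf.nonneg y) h1 h2

lemma op_nonneg {f : Ω → ℝ} (hf : ∀ x, 0 ≤ f x) (x : Ω) : 0 ≤ op S f x :=
  integral_nonneg hf

lemma LLogL.op [IsProbabilityMeasure P] [IsMarkovKernel S] (hS : S.Invariant P)
    {f : Ω → ℝ} (hf : LLogL P f) : LLogL P (op S f) where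
  measurable := measurable_op S hf.measurable
  nonneg := op_nonneg hf.nonneg
  integrable := by
    have hm := measurable_op S hf.measurable
    have hi := integrable_op hS hf.measurable_mul_log hf.integrable
    refine (hi.abs.add (integrable_const (1 : ℝ))).mono' (hm.mul hm.log).aestronglyMeasurable ?_
    filter_upwards [op_mul_log_le hS hf] with x hx
    rw [Real.norm_eq_abs, abs_le]
    have h1 := neg_one_le_mul_log (op_nonneg (S := S) hf.nonneg x)
    have h2 := abs_nonneg (EntContr.op S (fun y => f y * Real.log (f y)) x)
    have h3 := le_abs_self (EntContr.op S (fun y => f y * Real.log (f y)) x)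
    simp only [Pi.add_apply]
    constructor <;> linarith

lemma ent_op_le [IsProbabilityMeasure P] [IsMarkovKernel S] (hS : S.Invariant P)
    {f : Ω → ℝ} (hf : LLogL P f) : ent P (op S f) ≤ ent P f := by
  unfold ent
  rw [integral_op hS hf.integrable_self]
  have h := integral_mono_ae (LLogL.op hS hf).integrable
    (integrable_op hS hf.measurable_mul_log hf.integrable) (op_mul_log_le hS hf)
  rw [integral_op hS hf.integrable] at h
  linarith

/-- The entropy is the minimum over `c > 0` of `E[f log f] - E[f] log c - E[f] + c`. -/
lemma ent_le {f : Ω → ℝ} (hf : 0 < ∫ x, f x ∂P) {c : ℝ} (hc : 0 < c) :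
    ent P f ≤ ∫ x, f x * Real.log (f x) ∂P - (∫ x, f x ∂P) * Real.log c - ∫ x, f x ∂P + c := by
  unfold ent
  linarith [mul_log_tangent hc hf]

/-- **Gibbs' variational inequality**: `Ent(f) ≥ E[f log (g / E[g])]`. -/
lemma le_ent {f g : Ω → ℝ} (hf : ∀ x, 0 < f x) (hg : ∀ x, 0 < g x)
    (hf' : 0 < ∫ x, f x ∂P) (hg' : 0 < ∫ x, g x ∂P)
    (hfi : Integrable f P) (hgi : Integrable g P)
    (hff : Integrable (fun x => f x * Real.log (f x)) P)
    (hfg : Integrable (fun x => f x * Real.log (g x)) P) :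
    ∫ x, f x * Real.log (g x) ∂P - (∫ x, f x ∂P) * Real.log (∫ x, g x ∂P) ≤ ent P f := by
  set m := ∫ x, f x ∂P with hm
  set m₀ := ∫ x, g x ∂P with hm₀
  have key : ∫ x, (f x * Real.log (g x) + (Real.log (m / m₀) + 1) * f x - m / m₀ * g x) ∂P
      ≤ ∫ x, f x * Real.log (f x) ∂P := by
    refine integral_mono ((hfg.add (hfi.const_mul _)).sub (hgi.const_mul _)) hff fun x => ?_
    have h := mul_log_tangent (mul_pos (div_pos hf' hg') (hg x)) (hf x)
    rw [Real.log_mul (div_pos hf' hg').ne' (hg x).ne'] at h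
    dsimp only
    linarith
  have hi : Integrable (fun x => f x * Real.log (g x) + (Real.log (m / m₀) + 1) * f x) P :=
    hfg.add (hfi.const_mul _)
  rw [integral_sub hi (hgi.const_mul _), integral_add hfg (hfi.const_mul _),
    integral_const_mul, integral_const_mul, ← hm, ← hm₀,
    div_mul_cancel₀ _ hg'.ne', Real.log_div hf'.ne' hg'.ne'] at key
  unfold ent
  rw [← hm]
  linarith

/-! ### Logarithms of densities -/

/-- `log S e^u`, the action of the Markov operator `S` on logarithms of densities. -/
noncomputable def logOp (S : Kernel Ω Ω) (u : Ω → ℝ) (x : Ω) : ℝ :=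
  Real.log (op S (fun y => Real.exp (u y)) x)

lemma measurable_logOp {u : Ω → ℝ} (hu : Measurable u) : Measurable (logOp S u) :=
  (measurable_op S hu.exp).log

lemma abs_exp_le {α : Type*} {u : α → ℝ} {B : ℝ} (hB : ∀ x, |u x| ≤ B) (x : α) :
    |Real.exp (u x)| ≤ Real.exp B := by
  rw [abs_of_pos (Real.exp_pos _)]
  exact Real.exp_le_exp.2 (abs_le.1 (hB x)).2

lemma abs_op_le [IsMarkovKernel S] {u : Ω → ℝ} {B : ℝ} (hB : ∀ x, |u x| ≤ B) (x : Ω) :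
    |op S u x| ≤ B := by
  have := norm_integral_le_of_norm_le_const (μ := S x) (f := u) (C := B)
    (Filter.Eventually.of_forall hB)
  simpa [op] using this

section Bounded

variable [IsMarkovKernel S] {u : Ω → ℝ} {B : ℝ}

lemma exp_neg_le_op (hu : Measurable u) (hB : ∀ x, |u x| ≤ B) (x : Ω) :
    Real.exp (-B) ≤ op S (fun y => Real.exp (u y)) x := by
  have h : ∫ _, Real.exp (-B) ∂(S x) ≤ op S (fun y => Real.exp (u y)) x :=
    integral_mono (integrable_const _) (integrable_of_abs_le hu.exp (abs_exp_le hB))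
      fun y => Real.exp_le_exp.2 (abs_le.1 (hB y)).1
  simpa using h

lemma op_le_exp (hu : Measurable u) (hB : ∀ x, |u x| ≤ B) (x : Ω) :
    op S (fun y => Real.exp (u y)) x ≤ Real.exp B := by
  have h : op S (fun y => Real.exp (u y)) x ≤ ∫ _, Real.exp B ∂(S x) :=
    integral_mono (integrable_of_abs_le hu.exp (abs_exp_le hB)) (integrable_const _)
      fun y => Real.exp_le_exp.2 (abs_le.1 (hB y)).2
  simpa using h

lemma op_exp_pos (hu : Measurable u) (hB : ∀ x, |u x| ≤ B) (x : Ω) :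
    0 < op S (fun y => Real.exp (u y)) x :=
  (Real.exp_pos _).trans_le (exp_neg_le_op hu hB x)

lemma abs_logOp_le (hu : Measurable u) (hB : ∀ x, |u x| ≤ B) (x : Ω) : |logOp S u x| ≤ B := by
  rw [abs_le, logOp]
  exact ⟨(Real.le_log_iff_exp_le (op_exp_pos hu hB x)).2 (exp_neg_le_op hu hB x),
    (Real.log_le_iff_le_exp (op_exp_pos hu hB x)).2 (op_le_exp hu hB x)⟩

end Bounded

/-! ### Couplings -/

lemma IsCoupling.isProbabilityMeasure {μ ν : Measure Ω} [IsProbabilityMeasure μ]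
    {γ : Measure (Ω × Ω)} (h : IsCoupling μ ν γ) : IsProbabilityMeasure γ :=
  ⟨by rw [← measure_univ (μ := μ), ← h.1, Measure.map_apply measurable_fst .univ,
    Set.preimage_univ]⟩

lemma isCoupling_prod (μ ν : Measure Ω) [IsProbabilityMeasure μ] [IsProbabilityMeasure ν] :
    IsCoupling μ ν (μ.prod ν) := by
  constructor <;> simp [Measure.map_fst_prod, Measure.map_snd_prod]

lemma IsCoupling.ae_fst {μ ν : Measure Ω} {γ : Measure (Ω × Ω)} (h : IsCoupling μ ν γ)
    {p : Ω → Prop} (hp : ∀ᵐ x ∂μ, p x) : ∀ᵐ z ∂γ, p z.1 :=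
  ae_of_ae_map measurable_fst.aemeasurable (by rwa [h.1])

lemma IsCoupling.ae_snd {μ ν : Measure Ω} {γ : Measure (Ω × Ω)} (h : IsCoupling μ ν γ)
    {p : Ω → Prop} (hp : ∀ᵐ x ∂ν, p x) : ∀ᵐ z ∂γ, p z.2 :=
  ae_of_ae_map measurable_snd.aemeasurable (by rwa [h.2])

lemma IsCoupling.integral_fst {μ ν : Measure Ω} {γ : Measure (Ω × Ω)} (h : IsCoupling μ ν γ)
    {f : Ω → ℝ} (hf : Measurable f) : ∫ z, f z.1 ∂γ = ∫ x, f x ∂μ := by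
  rw [← h.1, integral_map measurable_fst.aemeasurable hf.aestronglyMeasurable]

lemma IsCoupling.integral_snd {μ ν : Measure Ω} {γ : Measure (Ω × Ω)} (h : IsCoupling μ ν γ)
    {f : Ω → ℝ} (hf : Measurable f) : ∫ z, f z.2 ∂γ = ∫ x, f x ∂ν := by
  rw [← h.2, integral_map measurable_snd.aemeasurable hf.aestronglyMeasurable]

/-! ### Essentially Lipschitz functions -/

section Metric

variable [MetricSpace Ω]

/-- `u` is `L`-Lipschitz outside of a `P`-null set. -/
def EssLipschitz (P : Measure Ω) (L : ℝ) (u : Ω → ℝ) : Prop :=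
  ∃ N : Set Ω, P N = 0 ∧ ∀ x, x ∉ N → ∀ y, y ∉ N → |u x - u y| ≤ L * dist x y

lemma exists_essLipschitz_of_essLip_lt_top {u : Ω → ℝ} (h : essLip P u < ∞) :
    ∃ L, 0 ≤ L ∧ EssLipschitz P L u := by
  unfold essLip at h
  simp only [iInf_lt_iff] at h
  obtain ⟨N, hN, h⟩ := h
  refine ⟨ENNReal.toReal (⨆ (x : Ω) (_ : x ∉ N) (y : Ω) (_ : y ∉ N) (_ : x ≠ y),
    ENNReal.ofReal (|u x - u y| / dist x y)), ENNReal.toReal_nonneg, N, hN, fun x hx y hy => ?_⟩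
  rcases eq_or_ne x y with rfl | hxy
  · simp
  have h1 : ENNReal.ofReal (|u x - u y| / dist x y) ≤
      ⨆ (x : Ω) (_ : x ∉ N) (y : Ω) (_ : y ∉ N) (_ : x ≠ y),
        ENNReal.ofReal (|u x - u y| / dist x y) :=
    le_iSup₂_of_le x hx (le_iSup₂_of_le y hy (le_iSup_of_le hxy le_rfl))
  rw [ENNReal.ofReal_le_iff_le_toReal h.ne, div_le_iff₀ (dist_pos.2 hxy)] at h1
  exact h1

/-- A coupling with `dist X Y < r` almost surely gives `E[e^{u(X)}] ≤ e^{L r} E[e^{u(Y)}]`. -/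
lemma logOp_le_of_wInf_lt [IsMarkovKernel S] {u : Ω → ℝ} {B L r : ℝ}
    (hu : Measurable u) (hB : ∀ x, |u x| ≤ B) (hL : 0 ≤ L) {N : Set Ω}
    (hN : ∀ x, x ∉ N → ∀ y, y ∉ N → |u x - u y| ≤ L * dist x y) {x y : Ω}
    (hx : ∀ᵐ z ∂(S x), z ∉ N) (hy : ∀ᵐ z ∂(S y), z ∉ N)
    (hr : WInf (S x) (S y) < ENNReal.ofReal r) :
    logOp S u x ≤ logOp S u y + L * r := by
  simp only [WInf, iInf_lt_iff] at hr
  obtain ⟨γ, hγ, hr⟩ := hr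
  have := hγ.isProbabilityMeasure
  have key : ∫ z, Real.exp (u z.1) ∂γ ≤ ∫ z, Real.exp (L * r) * Real.exp (u z.2) ∂γ := by
    refine integral_mono_ae
      (integrable_of_abs_le (hu.comp measurable_fst).exp fun z => abs_exp_le hB z.1)
      ((integrable_of_abs_le (hu.comp measurable_snd).exp fun z => abs_exp_le hB z.2).const_mul
        _) ?_
    filter_upwards [ae_lt_of_essSup_lt hr, hγ.ae_fst hx, hγ.ae_snd hy] with z h1 h2 h3
    rw [edist_dist, ENNReal.ofReal_lt_ofReal_iff_of_nonneg dist_nonneg] at h1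
    rw [← Real.exp_add, Real.exp_le_exp]
    have h4 := (abs_le.1 (hN _ h2 _ h3)).2
    have h5 := mul_le_mul_of_nonneg_left h1.le hL
    linarith
  rw [integral_const_mul, hγ.integral_fst hu.exp, hγ.integral_snd hu.exp] at key
  have h := Real.log_le_log (op_exp_pos hu hB x) key
  change _ ≤ Real.log (Real.exp (L * r) * op S (fun z => Real.exp (u z)) y) at h
  rw [Real.log_mul (Real.exp_pos _).ne' (op_exp_pos hu hB y).ne', Real.log_exp] at h
  unfold logOp
  linarith

/-- A kernel which is `ℓ`-Lipschitz for `W∞` contracts logarithmic Lipschitz constants by `ℓ`. -/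
lemma EssLipschitz.logOp [IsMarkovKernel S] (hS : S.Invariant P) {u : Ω → ℝ} {B L ℓ : ℝ}
    (hu : Measurable u) (hB : ∀ x, |u x| ≤ B) (hL : 0 ≤ L) (hℓ : 0 ≤ ℓ)
    (hsec : ∃ N : Set Ω, P N = 0 ∧ ∀ x, x ∉ N → ∀ y, y ∉ N →
      WInf (S x) (S y) ≤ ENNReal.ofReal (ℓ * dist x y))
    (h : EssLipschitz P L u) : EssLipschitz P (L * ℓ) (logOp S u) := by
  obtain ⟨N₁, hN₁, h₁⟩ := hsec
  obtain ⟨N₂, hN₂, h₂⟩ := h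
  have h₃ := ae_ae_of_invariant hS (p := fun x => x ∉ N₂) (measure_eq_zero_iff_ae_notMem.1 hN₂)
  -- besides `N₁`, exclude the points from which `S` charges `N₂`: a null set, by invariance
  refine ⟨N₁ ∪ {x | ¬ ∀ᵐ z ∂(S x), z ∉ N₂}, measure_union_null hN₁ h₃, ?_⟩
  have key : ∀ x, x ∉ N₁ ∪ {x | ¬ ∀ᵐ z ∂(S x), z ∉ N₂} →
      ∀ y, y ∉ N₁ ∪ {x | ¬ ∀ᵐ z ∂(S x), z ∉ N₂} →
      EntContr.logOp S u x - EntContr.logOp S u y ≤ L * ℓ * dist x y := by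
    intro x hx y hy
    simp only [Set.mem_union, Set.mem_ofPred_eq, not_or, not_not] at hx hy
    have hd : 0 ≤ ℓ * dist x y := mul_nonneg hℓ dist_nonneg
    have hlim : Filter.Tendsto (fun ε : ℝ => L * (ℓ * dist x y + ε)) (nhdsWithin 0 (Set.Ioi 0))
        (nhds (L * (ℓ * dist x y + 0))) :=
      (Continuous.tendsto (by fun_prop) 0).mono_left nhdsWithin_le_nhds
    have := ge_of_tendsto (b := EntContr.logOp S u x - EntContr.logOp S u y) hlim (by
      filter_upwards [self_mem_nhdsWithin] with ε hε
      have hlt := (h₁ x hx.1 y hy.1).trans_lt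
        ((ENNReal.ofReal_lt_ofReal_iff_of_nonneg hd).2 (lt_add_of_pos_right _ hε))
      linarith [logOp_le_of_wInf_lt hu hB hL h₂ hx.2 hy.2 hlt])
    linarith
  intro x hx y hy
  rw [abs_le]
  have h4 := key y hy x hx
  rw [dist_comm] at h4
  exact ⟨by linarith, key x hx y hy⟩

/-- The easy half of Kantorovich duality, for functions which are Lipschitz outside of a set that
neither measure charges. -/
lemma ofReal_abs_op_sub_le [IsMarkovKernel T] {v : Ω → ℝ} {B K : ℝ}
    (hv : Measurable v) (hB : ∀ x, |v x| ≤ B) {N : Set Ω}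
    (hN : ∀ x, x ∉ N → ∀ y, y ∉ N → |v x - v y| ≤ K * dist x y) {x y : Ω}
    (hx : ∀ᵐ z ∂(T x), z ∉ N) (hy : ∀ᵐ z ∂(T y), z ∉ N) :
    ENNReal.ofReal |op T v x - op T v y| ≤ ENNReal.ofReal K * W1 (T x) (T y) := by
  have key : ∀ γ, IsCoupling (T x) (T y) γ →
      ENNReal.ofReal |op T v x - op T v y| ≤ ENNReal.ofReal K * ∫⁻ p, edist p.1 p.2 ∂γ := by
    intro γ hγ
    have := hγ.isProbabilityMeasure
    have h1 : op T v x - op T v y = ∫ p, (v p.1 - v p.2) ∂γ := by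
      have hi₁ : Integrable (fun z => v z.1) γ :=
        integrable_of_abs_le (hv.comp measurable_fst) fun z => hB z.1
      have hi₂ : Integrable (fun z => v z.2) γ :=
        integrable_of_abs_le (hv.comp measurable_snd) fun z => hB z.2
      rw [integral_sub hi₁ hi₂, hγ.integral_fst hv, hγ.integral_snd hv]
      rfl
    rw [h1, ← Real.enorm_eq_ofReal_abs, ← lintegral_const_mul' _ _ ENNReal.ofReal_ne_top]
    refine (enorm_integral_le_lintegral_enorm _).trans (lintegral_mono_ae ?_)
    filter_upwards [hγ.ae_fst hx, hγ.ae_snd hy] with p h2 h3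
    rw [Real.enorm_eq_ofReal_abs, edist_dist, ← ENNReal.ofReal_mul' dist_nonneg]
    exact ENNReal.ofReal_le_ofReal (hN _ h2 _ h3)
  -- the case `K = 0` needs an actual coupling, since `W1` may be infinite and `0 * ∞ = 0`
  rcases eq_or_ne (ENNReal.ofReal K) 0 with h0 | h0
  · have := key _ (isCoupling_prod _ _)
    simpa [h0] using this
  · rw [W1, ENNReal.mul_iInf_of_ne h0 ENNReal.ofReal_ne_top]
    refine le_iInf fun γ => ?_
    rw [ENNReal.mul_iInf_of_ne h0 ENNReal.ofReal_ne_top]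
    exact le_iInf fun hγ => key γ hγ

/-- Averaged `W₁`-contraction: if each `v i` is `L ℓ i`-Lipschitz, then `∑ i, θ i T i (v i)` is
`(1 - κ) L`-Lipschitz. -/
lemma essLipschitz_sum_op {M : ℕ} {T : Fin M → Kernel Ω Ω} [∀ i, IsMarkovKernel (T i)]
    (hinv : ∀ i, (T i).Invariant P) {θ ℓ : Fin M → ℝ} (hθ : ∀ i, 0 ≤ θ i)
    {c L B : ℝ} (hc : 0 ≤ c) (hL : 0 ≤ L)
    (havg : ∃ N : Set Ω, P N = 0 ∧ ∀ x, x ∉ N → ∀ y, y ∉ N →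
      ∑ i, ENNReal.ofReal (θ i * ℓ i) * W1 (T i x) (T i y) ≤ ENNReal.ofReal (c * dist x y))
    {v : Fin M → Ω → ℝ} (hv : ∀ i, Measurable (v i)) (hB : ∀ i x, |v i x| ≤ B)
    (h : ∀ i, EssLipschitz P (L * ℓ i) (v i)) :
    EssLipschitz P (c * L) (fun x => ∑ i, θ i * op (T i) (v i) x) := by
  obtain ⟨N₁, hN₁, h₁⟩ := havg
  choose N hN h₂ using h
  have h₃ := fun i => ae_ae_of_invariant (hinv i) (p := fun x => x ∉ N i)
    (measure_eq_zero_iff_ae_notMem.1 (hN i))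
  refine ⟨N₁ ∪ ⋃ i, {x | ¬ ∀ᵐ z ∂(T i x), z ∉ N i},
    measure_union_null hN₁ (measure_iUnion_null h₃), fun x hx y hy => ?_⟩
  simp only [Set.mem_union, Set.mem_iUnion, Set.mem_ofPred_eq, not_or, not_exists, not_not] at hx hy
  rw [← ENNReal.ofReal_le_ofReal_iff (by positivity), ← Finset.sum_sub_distrib]
  calc ENNReal.ofReal |∑ i, (θ i * op (T i) (v i) x - θ i * op (T i) (v i) y)|
      ≤ ENNReal.ofReal (∑ i, θ i * |op (T i) (v i) x - op (T i) (v i) y|) := by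
        refine ENNReal.ofReal_le_ofReal ((Finset.abs_sum_le_sum_abs _ _).trans_eq ?_)
        refine Finset.sum_congr rfl fun i _ => ?_
        rw [← mul_sub, abs_mul, abs_of_nonneg (hθ i)]
    _ = ∑ i, ENNReal.ofReal (θ i) * ENNReal.ofReal |op (T i) (v i) x - op (T i) (v i) y| := by
        rw [ENNReal.ofReal_sum_of_nonneg fun i _ => mul_nonneg (hθ i) (abs_nonneg _)]
        exact Finset.sum_congr rfl fun i _ => ENNReal.ofReal_mul (hθ i)
    _ ≤ ∑ i, ENNReal.ofReal L * (ENNReal.ofReal (θ i * ℓ i) * W1 (T i x) (T i y)) := by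
        refine Finset.sum_le_sum fun i _ => ?_
        have h4 := ofReal_abs_op_sub_le (hv i) (hB i) (h₂ i) (hx.2 i) (hy.2 i)
        rw [ENNReal.ofReal_mul hL] at h4
        rw [ENNReal.ofReal_mul (hθ i)]
        exact (mul_le_mul_right h4 _).trans_eq (by ring)
    _ ≤ ENNReal.ofReal L * ENNReal.ofReal (c * dist x y) := by
        rw [← Finset.mul_sum]
        exact mul_le_mul_right (h₁ x hx.1 y hy.1) _
    _ = ENNReal.ofReal (c * L * dist x y) := by
        rw [← ENNReal.ofReal_mul hL]
        congr 1
        ring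

/-- For `u` bounded, the entropy of `e^u` is small when the Lipschitz constant of `u` is, because
`Ent(e^u) ≤ E[(e^u - e^a) (u - a)]` for all `a`; take for `a` a value of `u` at a point which is not
too far from `o`. -/
lemma ent_exp_le_of_essLipschitz [IsProbabilityMeasure P]
    {u : Ω → ℝ} {B L : ℝ} (hu : Measurable u) (hB : ∀ x, |u x| ≤ B) (hL : 0 ≤ L)
    {o : Ω} (ho : Integrable (fun x => dist o x) P) (h : EssLipschitz P L u) :
    ent P (fun x => Real.exp (u x)) ≤ 4 * Real.exp B * (∫ x, dist o x ∂P) * L := by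
  obtain ⟨N, hN, h⟩ := h
  obtain ⟨x₀, hx₀, hx₀'⟩ := exists_notMem_null_le_integral ho hN
  set D := ∫ x, dist o x ∂P with hD
  have hei : Integrable (fun x => Real.exp (u x)) P := integrable_of_abs_le hu.exp (abs_exp_le hB)
  have hui : Integrable (fun x => Real.exp (u x) * u x) P := by
    refine integrable_of_abs_le (hu.exp.mul hu) (B := Real.exp B * B) fun x => ?_
    rw [abs_mul]
    exact mul_le_mul (abs_exp_le hB x) (hB x) (abs_nonneg _) (Real.exp_pos _).le
  have hpos : 0 < ∫ x, Real.exp (u x) ∂P := integral_exp_pos hei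
  have h1 := ent_le hpos (Real.exp_pos (u x₀))
  simp only [Real.log_exp] at h1
  have key : ∫ x, (Real.exp (u x) * u x - (u x₀ + 1) * Real.exp (u x) + Real.exp (u x₀)) ∂P
      ≤ ∫ x, 2 * Real.exp B * L * (D + dist o x) ∂P := by
    refine integral_mono_ae ((hui.sub (hei.const_mul _)).add (integrable_const _))
      (((integrable_const _).add ho).const_mul _) ?_
    filter_upwards [measure_eq_zero_iff_ae_notMem.1 hN] with x hx
    have h2 : |u x - u x₀| ≤ L * (D + dist o x) := by
      refine (h x hx x₀ hx₀).trans (mul_le_mul_of_nonneg_left ?_ hL)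
      linarith [dist_triangle_left x x₀ o]
    have h3 : |Real.exp (u x) - Real.exp (u x₀)| ≤ 2 * Real.exp B := by
      linarith [abs_sub (Real.exp (u x)) (Real.exp (u x₀)), abs_exp_le hB x, abs_exp_le hB x₀]
    have h4 : (Real.exp (u x) - Real.exp (u x₀)) * (u x - u x₀)
        ≤ 2 * Real.exp B * (L * (D + dist o x)) := by
      refine (le_abs_self _).trans ?_
      rw [abs_mul]
      exact mul_le_mul h3 h2 (abs_nonneg _) (by positivity)
    have h5 := mul_log_tangent (Real.exp_pos (u x)) (Real.exp_pos (u x₀))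
    rw [Real.log_exp, Real.log_exp] at h5
    linarith
  have hi : Integrable (fun x => Real.exp (u x) * u x - (u x₀ + 1) * Real.exp (u x)) P :=
    hui.sub (hei.const_mul _)
  rw [integral_add hi (integrable_const _), integral_sub hui (hei.const_mul _),
    integral_const_mul, integral_const_mul, integral_add (integrable_const _) ho, ← hD] at key
  simp only [integral_const, probReal_univ, one_smul] at key
  linarith

end Metric

/-! ### Descent for the entropy deficit -/

/-- Truncation of a real number to `[-B, B]`. -/
def clip (B t : ℝ) : ℝ := max (-B) (min B t)

lemma abs_clip_le {B : ℝ} (hB : 0 ≤ B) (t : ℝ) : |clip B t| ≤ B :=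
  abs_le.2 ⟨le_max_left _ _, max_le (by linarith) (min_le_left _ _)⟩

lemma abs_clip_sub_clip_le (B s t : ℝ) : |clip B s - clip B t| ≤ |s - t| := by
  unfold clip
  rw [max_comm (-B), max_comm (-B), min_comm B, min_comm B]
  exact (abs_max_sub_max_le_abs _ _ _).trans (abs_min_sub_min_le_max _ _ _ _ |>.trans (by simp))

/-- On `[-B, B]`, the function `t ↦ e^t (t - 1 - w)` is minimal at the truncation of `w`. -/
lemma exp_clip_mul_le {B t : ℝ} (ht : |t| ≤ B) (w : ℝ) :
    Real.exp (clip B w) * (clip B w - 1 - w) ≤ Real.exp t * (t - 1 - w) := by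
  obtain ⟨h1, h2⟩ := abs_le.1 ht
  have htan := mul_log_tangent (Real.exp_pos (clip B w)) (Real.exp_pos t)
  rw [Real.log_exp, Real.log_exp] at htan
  have hsign : 0 ≤ (Real.exp t - Real.exp (clip B w)) * (clip B w - w) := by
    rcases le_total w (clip B w) with hw | hw
    · rcases hw.eq_or_lt with hw | hw
      · rw [← hw]; simp
      · refine mul_nonneg (sub_nonneg.2 (Real.exp_le_exp.2 ?_)) (sub_nonneg.2 hw.le)
        unfold clip at *
        grind
    · rcases hw.eq_or_lt with hw | hw
      · rw [hw]; simp
      · refine mul_nonneg_of_nonpos_of_nonpos (sub_nonpos.2 (Real.exp_le_exp.2 ?_))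
          (sub_nonpos.2 hw.le)
        unfold clip at *
        grind
  nlinarith

lemma lLogL_exp [IsProbabilityMeasure P] {u : Ω → ℝ} {B : ℝ} (hu : Measurable u)
    (hB : ∀ x, |u x| ≤ B) : LLogL P (fun x => Real.exp (u x)) where
  measurable := hu.exp
  nonneg x := (Real.exp_pos _).le
  integrable := by
    refine integrable_of_abs_le (hu.exp.mul hu.exp.log) (B := Real.exp B * B) fun x => ?_
    rw [Real.log_exp, abs_mul]
    exact mul_le_mul (abs_exp_le hB x) (hB x) (abs_nonneg _) (Real.exp_pos _).le

section Descent

variable {M : ℕ}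

/-- The linearisation `∑ i, θ i T i (log S i e^u)` at `e^u` of the averaged entropy
`f ↦ ∑ i, θ i Ent(S i f)`, up to an additive constant. -/
noncomputable def entGrad (T S : Fin M → Kernel Ω Ω) (θ : Fin M → ℝ) (u : Ω → ℝ) (x : Ω) : ℝ :=
  ∑ i, θ i * op (T i) (logOp (S i) u) x

/-- The deficit `lam Ent(e^u) - ∑ i, θ i Ent(S i e^u)`. -/
noncomputable def deficit (P : Measure Ω) (S : Fin M → Kernel Ω Ω) (θ : Fin M → ℝ) (lam : ℝ)
    (u : Ω → ℝ) : ℝ :=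
  lam * ent P (fun x => Real.exp (u x)) - ∑ i, θ i * ent P (op (S i) fun x => Real.exp (u x))

/-- One step of the descent: the truncation of the logarithm of the minimiser of
`lam (E[f log f] - E[f] log m - E[f]) - E[f (G - log m)]`, where `G = entGrad T S θ u` and
`m = E[e^u]`. -/
noncomputable def descent (P : Measure Ω) (T S : Fin M → Kernel Ω Ω) (θ : Fin M → ℝ) (lam B : ℝ)
    (u : Ω → ℝ) (x : Ω) : ℝ :=
  clip B (Real.log (∫ y, Real.exp (u y) ∂P) +
    (entGrad T S θ u x - Real.log (∫ y, Real.exp (u y) ∂P)) / lam)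

variable {T S : Fin M → Kernel Ω Ω} {θ : Fin M → ℝ} {u v : Ω → ℝ} {B B' lam : ℝ}

lemma measurable_entGrad (hu : Measurable u) : Measurable (entGrad T S θ u) :=
  Finset.measurable_fun_sum _ fun _ _ => (measurable_op _ (measurable_logOp hu)).const_mul _

lemma measurable_descent (hu : Measurable u) : Measurable (descent P T S θ lam B u) :=
  measurable_const.max (measurable_const.min
    ((((measurable_entGrad hu).sub_const _).div_const _).const_add _))

lemma abs_descent_le (hB : 0 ≤ B) (x : Ω) : |descent P T S θ lam B u x| ≤ B :=
  abs_clip_le hB _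

lemma EssLipschitz.clip [MetricSpace Ω] {w : Ω → ℝ} {L : ℝ} (h : EssLipschitz P L w) :
    EssLipschitz P L fun x => clip B (w x) := by
  obtain ⟨N, hN, h⟩ := h
  exact ⟨N, hN, fun x hx y hy => (abs_clip_sub_clip_le _ _ _).trans (h x hx y hy)⟩

lemma essLipschitz_descent [MetricSpace Ω] (hlam : 0 < lam) {L : ℝ}
    (h : EssLipschitz P L (entGrad T S θ u)) :
    EssLipschitz P (L / lam) (descent P T S θ lam B u) := by
  refine EssLipschitz.clip ?_
  obtain ⟨N, hN, h⟩ := h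
  refine ⟨N, hN, fun x hx y hy => ?_⟩
  rw [add_sub_add_left_eq_sub, ← sub_div, sub_sub_sub_cancel_right, abs_div, abs_of_pos hlam,
    div_mul_eq_mul_div]
  exact div_le_div_of_nonneg_right (h x hx y hy) hlam.le

variable [∀ i, IsMarkovKernel (T i)] [∀ i, IsMarkovKernel (S i)]

lemma abs_entGrad_le (hθ : ∀ i, 0 ≤ θ i) (hθsum : ∑ i, θ i = 1) (hu : Measurable u)
    (hB : ∀ x, |u x| ≤ B) (x : Ω) : |entGrad T S θ u x| ≤ B := by
  calc |entGrad T S θ u x| ≤ ∑ i, |θ i * op (T i) (logOp (S i) u) x| :=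
        Finset.abs_sum_le_sum_abs _ _
    _ ≤ ∑ i, θ i * B := by
        refine Finset.sum_le_sum fun i _ => ?_
        rw [abs_mul, abs_of_nonneg (hθ i)]
        exact mul_le_mul_of_nonneg_left (abs_op_le (abs_logOp_le hu hB) x) (hθ i)
    _ = B := by rw [← Finset.sum_mul, hθsum, one_mul]

lemma integrable_exp_mul [IsProbabilityMeasure P] (hv : Measurable v)
    (hB' : ∀ x, |v x| ≤ B') {g : Ω → ℝ} (hg : Measurable g) (hgB : ∀ x, |g x| ≤ B) :
    Integrable (fun x => Real.exp (v x) * g x) P := by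
  refine integrable_of_abs_le (hv.exp.mul hg) (B := Real.exp B' * B) fun x => ?_
  rw [abs_mul]
  exact mul_le_mul (abs_exp_le hB' x) (hgB x) (abs_nonneg _) (Real.exp_pos _).le

/-- The adjunction turns `∑ i, θ i E[(S i f) log (S i e^u)]` into `E[f G]`. -/
lemma sum_integral_op_mul_logOp [IsProbabilityMeasure P] (hadj : ∀ i, IsAdjoint P (T i) (S i))
    (hu : Measurable u) (hB : ∀ x, |u x| ≤ B) (hv : Measurable v) (hB' : ∀ x, |v x| ≤ B') :
    ∑ i, θ i * ∫ x, op (S i) (fun y => Real.exp (v y)) x * logOp (S i) u x ∂P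
      = ∫ x, Real.exp (v x) * entGrad T S θ u x ∂P := by
  have h : ∀ i, ∫ x, op (S i) (fun y => Real.exp (v y)) x * logOp (S i) u x ∂P
      = ∫ x, Real.exp (v x) * op (T i) (logOp (S i) u) x ∂P := fun i => by
    rw [hadj i _ _ (memLp_of_abs_le 2 hv.exp (abs_exp_le hB'))
      (memLp_of_abs_le 2 (measurable_logOp hu) (abs_logOp_le hu hB))]
    simp only [mul_comm]
  simp only [h, entGrad, Finset.mul_sum, ← integral_const_mul]
  rw [← integral_finsetSum]
  · refine integral_congr_ae (Filter.Eventually.of_forall fun x => ?_)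
    exact Finset.sum_congr rfl fun i _ => by ring
  · intro i _
    exact (integrable_exp_mul hv hB' (measurable_op _ (measurable_logOp hu))
      (abs_op_le (abs_logOp_le hu hB))).const_mul _

lemma sum_ent_op_eq [IsProbabilityMeasure P] (hadj : ∀ i, IsAdjoint P (T i) (S i))
    (hθsum : ∑ i, θ i = 1) (hu : Measurable u) (hB : ∀ x, |u x| ≤ B) :
    ∑ i, θ i * ent P (op (S i) fun x => Real.exp (u x))
      = ∫ x, Real.exp (u x) * entGrad T S θ u x ∂P
        - (∫ x, Real.exp (u x) ∂P) * Real.log (∫ x, Real.exp (u x) ∂P) := by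
  have hei : Integrable (fun x => Real.exp (u x)) P := integrable_of_abs_le hu.exp (abs_exp_le hB)
  simp only [ent, integral_op (hadj _).invariant hei, mul_sub, Finset.sum_sub_distrib]
  rw [← Finset.sum_mul, hθsum, one_mul, ← sum_integral_op_mul_logOp hadj hu hB hu hB]
  rfl

/-- The averaged entropy lies above its linearisations. -/
lemma le_sum_ent_op [IsProbabilityMeasure P] (hadj : ∀ i, IsAdjoint P (T i) (S i))
    (hθ : ∀ i, 0 ≤ θ i) (hθsum : ∑ i, θ i = 1) (hu : Measurable u) (hB : ∀ x, |u x| ≤ B)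
    (hv : Measurable v) (hB' : ∀ x, |v x| ≤ B') :
    ∫ x, Real.exp (v x) * entGrad T S θ u x ∂P
        - (∫ x, Real.exp (v x) ∂P) * Real.log (∫ x, Real.exp (u x) ∂P)
      ≤ ∑ i, θ i * ent P (op (S i) fun x => Real.exp (v x)) := by
  have hei : Integrable (fun x => Real.exp (u x)) P := integrable_of_abs_le hu.exp (abs_exp_le hB)
  have hvi : Integrable (fun x => Real.exp (v x)) P := integrable_of_abs_le hv.exp (abs_exp_le hB')
  rw [← sum_integral_op_mul_logOp hadj hu hB hv hB']
  have h : ∀ i, ∫ x, op (S i) (fun y => Real.exp (v y)) x * logOp (S i) u x ∂P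
      - (∫ x, Real.exp (v x) ∂P) * Real.log (∫ x, Real.exp (u x) ∂P)
      ≤ ent P (op (S i) fun x => Real.exp (v x)) := fun i => by
    have hS := (hadj i).invariant
    have h := le_ent (P := P) (op_exp_pos (S := S i) hv hB') (op_exp_pos (S := S i) hu hB)
      (by rw [integral_op hS hvi]; exact integral_exp_pos hvi)
      (by rw [integral_op hS hei]; exact integral_exp_pos hei)
      (integrable_op hS hv.exp hvi) (integrable_op hS hu.exp hei)
      ((lLogL_exp hv hB').op hS).integrable ?_
    · rwa [integral_op hS hei, integral_op hS hvi] at h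
    · refine integrable_of_abs_le (B := Real.exp B' * B)
        ((measurable_op _ hv.exp).mul (measurable_logOp hu)) fun x => ?_
      change |_ * logOp (S i) u x| ≤ _
      rw [abs_mul]
      exact mul_le_mul (abs_op_le (abs_exp_le hB') x) (abs_logOp_le hu hB x) (abs_nonneg _)
        (Real.exp_pos _).le
  have h2 := Finset.sum_le_sum fun i (_ : i ∈ Finset.univ) =>
    mul_le_mul_of_nonneg_left (h i) (hθ i)
  simp only [mul_sub, Finset.sum_sub_distrib] at h2
  rwa [← Finset.sum_mul, hθsum, one_mul] at h2

/-- The descent step does not increase the deficit: the deficit is dominated by the functional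
obtained by linearising the averaged entropy at `e^u`, with equality at `e^u`, and the new function
minimises an upper bound of that functional among functions with values in `[e^{-B}, e^B]`. -/
lemma deficit_descent_le [IsProbabilityMeasure P] (hadj : ∀ i, IsAdjoint P (T i) (S i))
    (hθ : ∀ i, 0 ≤ θ i) (hθsum : ∑ i, θ i = 1) (hlam : 0 < lam) (hB0 : 0 ≤ B)
    (hu : Measurable u) (hB : ∀ x, |u x| ≤ B) :
    deficit P S θ lam (descent P T S θ lam B u) ≤ deficit P S θ lam u := by
  set v := descent P T S θ lam B u with hvdef
  have hv : Measurable v := measurable_descent hu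
  have hB' : ∀ x, |v x| ≤ B := abs_descent_le hB0
  have hei : Integrable (fun x => Real.exp (u x)) P := integrable_of_abs_le hu.exp (abs_exp_le hB)
  have hvi : Integrable (fun x => Real.exp (v x)) P := integrable_of_abs_le hv.exp (abs_exp_le hB')
  have hG := measurable_entGrad (T := T) (S := S) (θ := θ) hu
  have hGB := abs_entGrad_le (T := T) (S := S) hθ hθsum hu hB
  have h1 := le_sum_ent_op hadj hθ hθsum hu hB hv hB'
  have h2 := sum_ent_op_eq (θ := θ) hadj hθsum hu hB
  have h3 := ent_le (integral_exp_pos hvi) (integral_exp_pos hei)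
  have huu := integrable_exp_mul (P := P) hu hB hu hB
  have hvv := integrable_exp_mul (P := P) hv hB' hv hB'
  have huG := integrable_exp_mul (P := P) hu hB hG hGB
  have hvG := integrable_exp_mul (P := P) hv hB' hG hGB
  simp only [Real.log_exp] at h3
  set m := ∫ x, Real.exp (u x) ∂P with hm
  set c := lam + lam * Real.log m - Real.log m with hc
  -- the functional minimised by `v`, integrated from its pointwise form
  have key : ∫ x, (lam * (Real.exp (v x) * v x) - c * Real.exp (v x)
        - Real.exp (v x) * entGrad T S θ u x) ∂P
      ≤ ∫ x, (lam * (Real.exp (u x) * u x) - c * Real.exp (u x)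
        - Real.exp (u x) * entGrad T S θ u x) ∂P := by
    refine integral_mono (((hvv.const_mul _).sub (hvi.const_mul _)).sub hvG)
      (((huu.const_mul _).sub (hei.const_mul _)).sub huG) fun x => ?_
    have h := mul_le_mul_of_nonneg_left
      (exp_clip_mul_le (hB x) (Real.log m + (entGrad T S θ u x - Real.log m) / lam)) hlam.le
    change lam * (Real.exp (v x) * (v x - 1 - _)) ≤ _ at h
    have e : ∀ t, lam * (Real.exp t * (t - 1 -
        (Real.log m + (entGrad T S θ u x - Real.log m) / lam)))
        = lam * (Real.exp t * t) - c * Real.exp t - Real.exp t * entGrad T S θ u x := fun t => by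
      rw [hc]
      field_simp
      ring
    rwa [e, e] at h
  have hi1 : Integrable (fun x => lam * (Real.exp (v x) * v x) - c * Real.exp (v x)) P :=
    (hvv.const_mul _).sub (hvi.const_mul _)
  have hi2 : Integrable (fun x => lam * (Real.exp (u x) * u x) - c * Real.exp (u x)) P :=
    (huu.const_mul _).sub (hei.const_mul _)
  rw [integral_sub hi1 hvG, integral_sub (hvv.const_mul _) (hvi.const_mul _),
    integral_sub hi2 huG, integral_sub (huu.const_mul _) (hei.const_mul _)] at key
  simp only [integral_const_mul] at key
  rw [← hm] at key
  have h4 := mul_le_mul_of_nonneg_left h3 hlam.le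
  have h5 : ent P (fun x => Real.exp (u x))
      = ∫ x, Real.exp (u x) * u x ∂P - m * Real.log m := by
    simp only [ent, Real.log_exp, hm]
  unfold deficit
  rw [h2, h5]
  set I := ∫ x, Real.exp (v x) ∂P
  set Iv := ∫ x, Real.exp (v x) * v x ∂P
  set Iu := ∫ x, Real.exp (u x) * u x ∂P
  rw [hc] at key
  linarith

/-! ### Entropy contraction for bounded logarithms -/

variable [MetricSpace Ω]

/-- The deficit of `e^u` is nonnegative as soon as `u` is bounded and essentially Lipschitz: along
the iterated descent, the deficit decreases, the functions remain in `[-B, B]`, and the Lipschitz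
constants decay geometrically, so that the deficits have a nonnegative lower limit. -/
lemma deficit_nonneg_of_essLipschitz [IsProbabilityMeasure P]
    (hadj : ∀ i, IsAdjoint P (T i) (S i)) (hinv : ∀ i, (T i).Invariant P)
    (hθ : ∀ i, 0 ≤ θ i) (hθsum : ∑ i, θ i = 1)
    {ℓ : Fin M → ℝ} (hℓ : ∀ i, 0 ≤ ℓ i) {c : ℝ} (hc : 0 ≤ c) (hcl : c < lam)
    (hsec : ∀ i, ∃ N : Set Ω, P N = 0 ∧ ∀ x, x ∉ N → ∀ y, y ∉ N →
      WInf (S i x) (S i y) ≤ ENNReal.ofReal (ℓ i * dist x y))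
    (havg : ∃ N : Set Ω, P N = 0 ∧ ∀ x, x ∉ N → ∀ y, y ∉ N →
      ∑ i, ENNReal.ofReal (θ i * ℓ i) * W1 (T i x) (T i y) ≤ ENNReal.ofReal (c * dist x y))
    {o : Ω} (ho : Integrable (fun x => dist o x) P) (hB0 : 0 ≤ B)
    (hu : Measurable u) (hB : ∀ x, |u x| ≤ B) {L : ℝ} (hL : 0 ≤ L) (h : EssLipschitz P L u) :
    0 ≤ deficit P S θ lam u := by
  have hlam : 0 < lam := hc.trans_lt hcl
  set D := 4 * Real.exp B * (∫ x, dist o x ∂P) with hD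
  have hD0 : 0 ≤ D := mul_nonneg (by positivity) (integral_nonneg fun x => dist_nonneg)
  have key : ∀ n : ℕ, ∀ (u : Ω → ℝ) (L : ℝ), Measurable u → (∀ x, |u x| ≤ B) → 0 ≤ L →
      EssLipschitz P L u → -(D * L * (c / lam) ^ n) ≤ deficit P S θ lam u := by
    intro n
    induction n with
    | zero =>
      intro u L hu hB hL h
      have h1 := ent_exp_le_of_essLipschitz hu hB hL ho h
      have hE := lLogL_exp (P := P) hu hB
      have hei : Integrable (fun x => Real.exp (u x)) P := hE.integrable_self
      have h0 : 0 ≤ ent P fun x => Real.exp (u x) := by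
        have := le_ent (P := P) (f := fun x => Real.exp (u x)) (g := fun _ => 1)
          (fun x => Real.exp_pos _) (fun _ => one_pos) (integral_exp_pos hei) (by simp) hei
          (integrable_const _) hE.integrable (by simp)
        simpa using this
      have h2 : ∑ i, θ i * ent P (op (S i) fun x => Real.exp (u x))
          ≤ ∑ i, θ i * ent P (fun x => Real.exp (u x)) :=
        Finset.sum_le_sum fun i _ =>
          mul_le_mul_of_nonneg_left (ent_op_le (hadj i).invariant hE) (hθ i)
      rw [← Finset.sum_mul, hθsum, one_mul] at h2
      -- the deficit is at least `-Ent(e^u)`, which the Lipschitz constant controls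
      have h3 := mul_nonneg hlam.le h0
      unfold deficit
      rw [pow_zero, mul_one]
      linarith
    | succ n ih =>
      intro u L hu hB hL h
      have hG : EssLipschitz P (c * L) (entGrad T S θ u) :=
        essLipschitz_sum_op hinv hθ hc hL havg (fun i => measurable_logOp hu)
          (fun i => abs_logOp_le hu hB)
          fun i => h.logOp (hadj i).invariant hu hB hL (hℓ i) (hsec i)
      have h1 := ih (descent P T S θ lam B u) (c * L / lam) (measurable_descent hu)
        (abs_descent_le hB0) (by positivity) (essLipschitz_descent hlam hG)
      refine le_trans (le_of_eq ?_) (h1.trans (deficit_descent_le hadj hθ hθsum hlam hB0 hu hB))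
      rw [pow_succ]
      ring
  have hlim : Filter.Tendsto (fun n : ℕ => -(D * L * (c / lam) ^ n)) Filter.atTop
      (nhds (-(D * L * 0))) :=
    ((tendsto_pow_atTop_nhds_zero_of_lt_one (by positivity) ((div_lt_one hlam).2 hcl)).const_mul
      _).neg
  rw [mul_zero, neg_zero] at hlim
  exact le_of_tendsto' hlim fun n => by simpa using key n u L hu hB hL h

/-- Entropy contraction for `e^u` with `u` bounded. The regularity assumption makes the first
descent step essentially Lipschitz. -/
lemma sum_ent_op_exp_le [IsProbabilityMeasure P]
    (hadj : ∀ i, IsAdjoint P (T i) (S i)) (hinv : ∀ i, (T i).Invariant P)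
    (hθ : ∀ i, 0 ≤ θ i) (hθsum : ∑ i, θ i = 1)
    {ℓ : Fin M → ℝ} (hℓ : ∀ i, 0 ≤ ℓ i) {c : ℝ} (hc : 0 ≤ c)
    (hsec : ∀ i, ∃ N : Set Ω, P N = 0 ∧ ∀ x, x ∉ N → ∀ y, y ∉ N →
      WInf (S i x) (S i y) ≤ ENNReal.ofReal (ℓ i * dist x y))
    (havg : ∃ N : Set Ω, P N = 0 ∧ ∀ x, x ∉ N → ∀ y, y ∉ N →
      ∑ i, ENNReal.ofReal (θ i * ℓ i) * W1 (T i x) (T i y) ≤ ENNReal.ofReal (c * dist x y))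
    (hreg : ∀ i, ∀ f : Ω → ℝ, MemLp f ∞ P → essLip P (op (T i) f) < ∞)
    {o : Ω} (ho : Integrable (fun x => dist o x) P)
    (hu : Measurable u) (hB : ∀ x, |u x| ≤ B) :
    ∑ i, θ i * ent P (op (S i) fun x => Real.exp (u x)) ≤ c * ent P fun x => Real.exp (u x) := by
  have hB0 : 0 ≤ B := (abs_nonneg _).trans (hB o)
  have hLip : ∀ i, ∃ L, 0 ≤ L ∧ EssLipschitz P L (op (T i) (logOp (S i) u)) := fun i =>
    exists_essLipschitz_of_essLip_lt_top
      (hreg i _ (memLp_of_abs_le _ (measurable_logOp hu) (abs_logOp_le hu hB)))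
  choose K hK0 N hN hK using hLip
  have hG : EssLipschitz P (∑ i, θ i * K i) (entGrad T S θ u) := by
    refine ⟨⋃ i, N i, measure_iUnion_null hN, fun x hx y hy => ?_⟩
    simp only [Set.mem_iUnion, not_exists] at hx hy
    rw [entGrad, entGrad, ← Finset.sum_sub_distrib, Finset.sum_mul]
    refine (Finset.abs_sum_le_sum_abs _ _).trans (Finset.sum_le_sum fun i _ => ?_)
    rw [← mul_sub, abs_mul, abs_of_nonneg (hθ i), mul_assoc]
    exact mul_le_mul_of_nonneg_left (hK i x (hx i) y (hy i)) (hθ i)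
  have hL0 : 0 ≤ ∑ i, θ i * K i := Finset.sum_nonneg fun i _ => mul_nonneg (hθ i) (hK0 i)
  have key : ∀ lam, c < lam → 0 ≤ deficit P S θ lam u := fun lam hcl =>
    have hlam := hc.trans_lt hcl
    (deficit_nonneg_of_essLipschitz hadj hinv hθ hθsum hℓ hc hcl hsec havg ho hB0
      (measurable_descent hu) (abs_descent_le hB0) (div_nonneg hL0 hlam.le)
      (essLipschitz_descent hlam hG)).trans (deficit_descent_le hadj hθ hθsum hlam hB0 hu hB)
  have hlim : Filter.Tendsto (fun lam : ℝ => deficit P S θ lam u) (nhdsWithin c (Set.Ioi c))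
      (nhds (deficit P S θ c u)) := by
    refine (Continuous.tendsto ?_ c).mono_left nhdsWithin_le_nhds
    unfold deficit
    fun_prop
  have := ge_of_tendsto hlim (by filter_upwards [self_mem_nhdsWithin] with lam h using key lam h)
  unfold deficit at this
  linarith

end Descent

/-! ### Approximation of functions in `L log L` by bounded functions -/

/-- Truncation of a real number to `[e^{-k}, e^k]`. -/
noncomputable def truncation (k : ℕ) (t : ℝ) : ℝ :=
  max (Real.exp (-k)) (min (Real.exp k) t)

lemma truncation_pos (k : ℕ) (t : ℝ) : 0 < truncation k t :=
  (Real.exp_pos _).trans_le (le_max_left _ _)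

lemma abs_log_truncation_le (k : ℕ) (t : ℝ) : |Real.log (truncation k t)| ≤ k := by
  rw [abs_le, Real.le_log_iff_exp_le (truncation_pos k t),
    Real.log_le_iff_le_exp (truncation_pos k t)]
  have hk : (0 : ℝ) ≤ k := Nat.cast_nonneg k
  exact ⟨le_max_left _ _, max_le (Real.exp_le_exp.2 (by linarith))
    (min_le_left _ _)⟩

lemma measurable_truncation (k : ℕ) : Measurable (truncation k) :=
  measurable_const.max (measurable_const.min measurable_id)

lemma tendsto_truncation {t : ℝ} (ht : 0 ≤ t) :
    Filter.Tendsto (fun k : ℕ => truncation k t) Filter.atTop (nhds t) := by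
  have h1 : Filter.Tendsto (fun k : ℕ => Real.exp (-(k : ℝ))) Filter.atTop (nhds 0) :=
    Real.tendsto_exp_neg_atTop_nhds_zero.comp tendsto_natCast_atTop_atTop
  have h2 : Filter.Tendsto (fun k : ℕ => min (Real.exp k) t) Filter.atTop (nhds t) := by
    refine tendsto_const_nhds.congr' ?_
    filter_upwards [(Real.tendsto_exp_atTop.comp
      tendsto_natCast_atTop_atTop).eventually_ge_atTop t] with k hk
    exact (min_eq_right hk).symm
  simpa [truncation, ht] using h1.max h2

lemma truncation_le (k : ℕ) {t : ℝ} (ht : 0 ≤ t) : truncation k t ≤ 1 + t := by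
  have h : Real.exp (-(k : ℝ)) ≤ 1 := Real.exp_le_one_iff.2 (by simp)
  exact max_le (by linarith) ((min_le_right _ _).trans (by linarith))

lemma abs_truncation_mul_log_le (k : ℕ) {t : ℝ} (ht : 0 ≤ t) :
    |truncation k t * Real.log (truncation k t)| ≤ 1 + |t * Real.log t| := by
  have h0 := truncation_pos k t
  have habs := abs_nonneg (t * Real.log t)
  rcases le_total (truncation k t) 1 with h1 | h1
  · rw [abs_le]
    have h2 := mul_nonpos_of_nonneg_of_nonpos h0.le (Real.log_nonpos h0.le h1)
    constructor <;> linarith [neg_one_le_mul_log h0.le]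
  · have hk : Real.exp (-(k : ℝ)) ≤ 1 := Real.exp_le_one_iff.2 (by simp)
    have h2 : truncation k t = 1 ∨ truncation k t ≤ t := by
      unfold truncation at *
      grind
    rcases h2 with h2 | h2
    · rw [h2, Real.log_one, mul_zero, abs_zero]
      linarith
    · have h3 := Real.log_nonneg h1
      rw [abs_of_nonneg (mul_nonneg h0.le h3)]
      have h4 := mul_le_mul h2 (Real.log_le_log h0 h2) h3 ht
      linarith [le_abs_self (t * Real.log t)]

lemma lLogL_truncation [IsProbabilityMeasure P] {f : Ω → ℝ} (hf : LLogL P f) (k : ℕ) :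
    LLogL P fun x => truncation k (f x) where
  measurable := (measurable_truncation k).comp hf.measurable
  nonneg x := (truncation_pos k _).le
  integrable := by
    have hm := (measurable_truncation k).comp hf.measurable
    refine ((integrable_const (1 : ℝ)).add hf.integrable.abs).mono'
      (hm.mul hm.log).aestronglyMeasurable (Filter.Eventually.of_forall fun x => ?_)
    exact abs_truncation_mul_log_le k (hf.nonneg x)

/-- Dominated convergence for the entropy. -/
lemma tendsto_ent {f : Ω → ℝ} {F : ℕ → Ω → ℝ} {g₁ g₂ : Ω → ℝ} (hF : ∀ k, Measurable (F k))
    (hg₁ : Integrable g₁ P) (hg₂ : Integrable g₂ P)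
    (h₁ : ∀ k, ∀ᵐ x ∂P, |F k x| ≤ g₁ x) (h₂ : ∀ k, ∀ᵐ x ∂P, |F k x * Real.log (F k x)| ≤ g₂ x)
    (hlim : ∀ᵐ x ∂P, Filter.Tendsto (fun k => F k x) Filter.atTop (nhds (f x))) :
    Filter.Tendsto (fun k => ent P (F k)) Filter.atTop (nhds (ent P f)) := by
  refine Filter.Tendsto.sub ?_ ?_
  · refine tendsto_integral_of_dominated_convergence g₂
      (fun k => ((hF k).mul (hF k).log).aestronglyMeasurable) hg₂ h₂ ?_
    filter_upwards [hlim] with x hx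
    exact (Real.continuous_mul_log.tendsto _).comp hx
  · exact (Real.continuous_mul_log.tendsto _).comp (tendsto_integral_of_dominated_convergence g₁
      (fun k => (hF k).aestronglyMeasurable) hg₁ h₁ hlim)

lemma tendsto_ent_truncation [IsProbabilityMeasure P] {f : Ω → ℝ} (hf : LLogL P f) :
    Filter.Tendsto (fun k => ent P fun x => truncation k (f x)) Filter.atTop
      (nhds (ent P f)) := by
  refine tendsto_ent (fun k => (lLogL_truncation hf k).measurable)
    ((integrable_const (1 : ℝ)).add hf.integrable_self)
    ((integrable_const (1 : ℝ)).add hf.integrable.abs)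
    (fun k => Filter.Eventually.of_forall fun x => ?_)
    (fun k => Filter.Eventually.of_forall fun x => abs_truncation_mul_log_le k (hf.nonneg x))
    (Filter.Eventually.of_forall fun x => tendsto_truncation (hf.nonneg x))
  rw [abs_of_pos (truncation_pos _ _)]
  exact truncation_le k (hf.nonneg x)

lemma tendsto_ent_op_truncation [IsProbabilityMeasure P] [IsMarkovKernel S] (hS : S.Invariant P)
    {f : Ω → ℝ} (hf : LLogL P f) :
    Filter.Tendsto (fun k => ent P (op S fun x => truncation k (f x))) Filter.atTop
      (nhds (ent P (op S f))) := by
  have hi₁ : Integrable (fun x => 1 + f x) P := (integrable_const (1 : ℝ)).add hf.integrable_self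
  have hi₂ : Integrable (fun x => 1 + |f x * Real.log (f x)|) P :=
    (integrable_const (1 : ℝ)).add hf.integrable.abs
  have hm₂ : Measurable (fun x => 1 + |f x * Real.log (f x)|) :=
    hf.measurable_mul_log.norm.const_add 1
  refine tendsto_ent (fun k => measurable_op S (lLogL_truncation hf k).measurable)
    (integrable_op hS (hf.measurable.const_add 1) hi₁)
    ((integrable_const (1 : ℝ)).add (integrable_op hS hm₂ hi₂)) (fun k => ?_) (fun k => ?_) ?_
  · filter_upwards [ae_integrable_of_invariant hS hi₁,
      ae_integrable_of_invariant hS (lLogL_truncation hf k).integrable_self] with x h1 h2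
    rw [abs_of_nonneg (op_nonneg (lLogL_truncation hf k).nonneg x)]
    exact integral_mono h2 h1 fun y => truncation_le k (hf.nonneg y)
  · filter_upwards [ae_integrable_of_invariant hS hi₂,
      ae_integrable_of_invariant hS (lLogL_truncation hf k).integrable,
      op_mul_log_le hS (lLogL_truncation hf k)] with x h1 h2 h3
    have h4 : op S (fun y => truncation k (f y) * Real.log (truncation k (f y))) x
        ≤ op S (fun y => 1 + |f y * Real.log (f y)|) x :=
      integral_mono h2 h1 fun y =>
        (le_abs_self _).trans (abs_truncation_mul_log_le k (hf.nonneg y))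
    have h5 := neg_one_le_mul_log (op_nonneg (S := S) (lLogL_truncation hf k).nonneg x)
    have h6 : 0 ≤ op S (fun y => 1 + |f y * Real.log (f y)|) x :=
      op_nonneg (fun y => by positivity) x
    rw [abs_le]
    simp only [Pi.add_apply]
    constructor <;> linarith
  · filter_upwards [ae_integrable_of_invariant hS hi₁] with x h1
    refine tendsto_integral_of_dominated_convergence _
      (fun k => (lLogL_truncation hf k).measurable.aestronglyMeasurable) h1
      (fun k => Filter.Eventually.of_forall fun y => ?_)
      (Filter.Eventually.of_forall fun y => tendsto_truncation (hf.nonneg y))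
    rw [Real.norm_eq_abs, abs_of_pos (truncation_pos _ _)]
    exact truncation_le k (hf.nonneg y)

end EntContr

theorem theorem1p2 {Ω : Type*} [MeasurableSpace Ω] [MetricSpace Ω]
    (P : Measure Ω) [IsProbabilityMeasure P]
    -- the metric is measurable (for the given σ-algebra, which need not be the Borel one)
    (hdist : Measurable (fun p : Ω × Ω => dist p.1 p.2))
    (hsq : ∃ o : Ω, Integrable (fun x => dist o x ^ 2) P)
    {M : ℕ} (T Tstar : Fin M → Kernel Ω Ω)
    [∀ i, IsMarkovKernel (T i)] [∀ i, IsMarkovKernel (Tstar i)]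
    -- the kernels preserve `P`, and `Tstar i` is the adjoint of `T i`
    (hinv : ∀ i, (T i).Invariant P)
    (hadj : ∀ i, EntContr.IsAdjoint P (T i) (Tstar i))
    (θ : Fin M → ℝ) (hθ : ∀ i, 0 ≤ θ i) (hθsum : ∑ i, θ i = 1)
    (ℓ : Fin M → ℝ) (hℓ : ∀ i, 0 ≤ ℓ i)
    (κ : ℝ) (hκ0 : 0 ≤ κ) (hκ1 : κ ≤ 1)
    -- (i) sectional curvature
    (hsec : ∀ i, ∃ N : Set Ω, P N = 0 ∧ ∀ x, x ∉ N → ∀ y, y ∉ N →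
      EntContr.WInf (Tstar i x) (Tstar i y) ≤ ENNReal.ofReal (ℓ i * dist x y))
    -- (ii) average curvature
    (havg : ∃ N : Set Ω, P N = 0 ∧ ∀ x, x ∉ N → ∀ y, y ∉ N →
      ∑ i, ENNReal.ofReal (θ i * ℓ i) * EntContr.W1 (T i x) (T i y)
        ≤ ENNReal.ofReal ((1 - κ) * dist x y))
    -- (iii) regularity
    (hreg : ∀ i, ∀ f : Ω → ℝ, MemLp f ∞ P → EntContr.essLip P (EntContr.op (T i) f) < ∞) :
    ∀ f : Ω → ℝ, EntContr.LLogL P f →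
      (∀ i, EntContr.LLogL P (EntContr.op (Tstar i) f)) ∧
      ∑ i, θ i * EntContr.ent P (EntContr.op (Tstar i) f) ≤ (1 - κ) * EntContr.ent P f := by
  obtain ⟨o, ho⟩ := hsq
  have ho₁ : Integrable (fun x => dist o x) P := by
    have hm : AEStronglyMeasurable (fun x => dist o x) P :=
      (hdist.comp measurable_prodMk_left).aestronglyMeasurable
    exact ((memLp_two_iff_integrable_sq hm).2 ho).integrable one_le_two
  intro f hf
  have hS := fun i => (hadj i).invariant
  refine ⟨fun i => hf.op (hS i), ?_⟩
  refine le_of_tendsto_of_tendsto'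
    (tendsto_finsetSum Finset.univ fun i _ =>
      (EntContr.tendsto_ent_op_truncation (hS i) hf).const_mul (θ i))
    ((EntContr.tendsto_ent_truncation hf).const_mul (1 - κ)) fun k => ?_
  have h := EntContr.sum_ent_op_exp_le hadj hinv hθ hθsum hℓ (sub_nonneg.2 hκ1) hsec havg hreg ho₁
    (EntContr.lLogL_truncation hf k).measurable.log
    fun x => EntContr.abs_log_truncation_le k (f x)
  simpa only [Real.exp_log (EntContr.truncation_pos k _)] using h
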